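/- Let $n,l\in\mathbb N$ with $l\ge 1$, let $\gamma\in\mathbb R$ and let $\psi\in H^\gamma(\mathbb R^n)$, where $H^s(\mathbb R^n)=\{u\in\mathcal S'(\mathbb R^n):(1+|\xi|^2)^{s/2}\hat u\in L^2(\mathbb R^n)\}$ is the $L^2$-based Sobolev space of complex-valued distributions with its usual norm. Then the problem $$\partial_t^2 v-t^{2l-1}\Delta v=0\quad\text{on }\mathbb R\times\mathbb R^n,\qquad v(0,\cdot)=\psi,$$ has a solution $$v\in C\big(\mathbb R,H^\gamma(\mathbb R^n)\big)\cap C^1\big(\mathbb R,H^{\gamma-\frac{2l+3}{2(2l+1)}}(\mathbb R^n)\big).$$ Here the equation is understood as follows: for every Schwartz function $\phi$ on $\mathbb R^n$ the function $t\mapsto\langle v(t),\phi\rangle$ is $C^2$ on $\mathbb R$, and $\frac{d^2}{dt^2}\langle v(t),\phi\rangle=t^{2l-1}\langle\Delta v(t),\phi\rangle$ for every $t\in\mathbb R$. -/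

import Mathlib

open MeasureTheory TemperedDistribution
open scoped SchwartzMap Laplacian

/-- A curve `v : ℝ → 𝓢'(ℝⁿ)` belongs to `C^k(ℝ, H^s(ℝⁿ))`. The space `H^s` consists of the
tempered distributions `u` with `⟨D⟩^s u ∈ L²`, normed by `‖u‖_{H^s} = ‖⟨D⟩^s u‖_{L²}`, so that the
Bessel potential `⟨D⟩^s` is an isometric isomorphism of `H^s` onto `L²`. Hence `v` is a `C^k` curve
in `H^s` exactly when all `⟨D⟩^s v(t)` lie in `L²` and `t ↦ ⟨D⟩^s v(t)` is a `C^k` curve in the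
Banach space `L²` (for its norm topology). -/
def SobolevContDiff {n : ℕ} (k : ℕ) (s : ℝ) (v : ℝ → 𝓢'(EuclideanSpace ℝ (Fin n), ℂ)) : Prop :=
  ∃ g : ℝ → Lp ℂ 2 (volume : Measure (EuclideanSpace ℝ (Fin n))),
    ContDiff ℝ k g ∧
      ∀ t, besselPotential (EuclideanSpace ℝ (Fin n)) ℂ s (v t) =
        (g t : 𝓢'(EuclideanSpace ℝ (Fin n), ℂ))

/-- The curve `v : ℝ → 𝓢'(ℝⁿ)` solves `∂_t² v - t^(2l-1) Δ v = 0` on `ℝ × ℝⁿ`: tested against every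
Schwartz function `φ` of `x`, the function `t ↦ ⟨v(t), φ⟩` is `C²` on all of `ℝ`, and its second
derivative is `t^(2l-1) ⟨Δ v(t), φ⟩` at every `t`, where `Δ` is the distributional Laplacian.
For continuous curves this is the same as the equation in the sense of distributions
on `ℝ × ℝⁿ`. -/
def SolvesGeneralizedTricomi {n : ℕ} (l : ℕ) (v : ℝ → 𝓢'(EuclideanSpace ℝ (Fin n), ℂ)) : Prop :=
  ∀ φ : 𝓢(EuclideanSpace ℝ (Fin n), ℂ),
    ContDiff ℝ 2 (fun t : ℝ => v t φ) ∧
      ∀ t : ℝ, iteratedDeriv 2 (fun τ : ℝ => v τ φ) t - (t : ℂ) ^ (2 * l - 1) * (Δ (v t)) φ = 0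

/-! After a Fourier transform in space the equation becomes, at each frequency `ξ`, `y'' = -t^(2l-1)
(2π‖ξ‖)² y`. With `m = 2l-1` and `μ = (2π‖ξ‖)^(2/(2l+1))`, the function `A(tμ)` solves it whenever
`A'' + x^m A = 0`. So a single solution `A` with `A 0 = 1`, bounded on all of `ℝ`, gives `v(t)` as
the Fourier multiplier `A(tμ)` applied to `ψ`, and this preserves `H^γ`.

Since `m` is odd, solutions are a combination of growing and decaying ones at `-∞`;
`exists_decaying_solution` selects a bounded one there. At `+∞` every solution oscillates, and
`exists_energy_bound` gives `A'² + x^m A² = O(x^(m/2))`. Hence `A` is bounded and `A' = O(x^(m/4))`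
(`exists_airy`). The symbol `μ A'(tμ)` of `∂ₜ v` then grows at most like `μ^(1+m/4)`, that is
`‖ξ‖^((2l+3)/(2(2l+1)))`, which is the stated loss (`exists_scale_mul_deriv_bound`).

Pointwise regularity of the symbols in `t` passes to `L²` by dominated convergence
(`continuous_mulLp`, `hasDerivAt_mulLp`). -/

/-! ### Power series solutions of `y'' = x^m y`. -/

/-- Coefficients of the power series solutions of `y'' = x ^ m * y`. -/
noncomputable def airyCoeff (m e : ℕ) : ℕ → ℝ
  | 0 => 1
  | k + 1 => airyCoeff m e k /
      ((((k + 1) * (m + 2) + e : ℕ) : ℝ) * (((k + 1) * (m + 2) + e : ℕ) - 1))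

lemma airyCoeff_nonneg (m e k : ℕ) : 0 ≤ airyCoeff m e k := by
  induction k with
  | zero => simp [airyCoeff]
  | succ k ih =>
    rw [airyCoeff]
    have : (1 : ℝ) ≤ (((k + 1) * (m + 2) + e : ℕ) : ℝ) := by
      norm_cast; nlinarith
    exact div_nonneg ih (mul_nonneg (by linarith) (by linarith))

/-- With `N` the degree of the new term, the recursion divides by `N (N - 1)`, and `N - 1 ≥ k + 1`
alone produces the factorial. The factor `N` is left over to absorb one differentiation. -/
lemma airyCoeff_mul_degree_le {m e : ℕ} (he : e ≤ 1) (k : ℕ) :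
    airyCoeff m e k ≤ 1 / (k.factorial : ℝ) ∧
      airyCoeff m e k * ((k * (m + 2) + e : ℕ) : ℝ) ≤ 1 / (k.factorial : ℝ) := by
  induction k with
  | zero => simpa [airyCoeff] using he
  | succ k ih =>
    have h0 := airyCoeff_nonneg m e k
    have hN : (k : ℝ) + 2 ≤ (((k + 1) * (m + 2) + e : ℕ) : ℝ) := by
      norm_cast; nlinarith
    have hk : (0 : ℝ) ≤ k := Nat.cast_nonneg k
    rw [airyCoeff]
    set N : ℝ := (((k + 1) * (m + 2) + e : ℕ) : ℝ)
    have key : airyCoeff m e k / (N - 1) ≤ 1 / ((k + 1).factorial : ℝ) := by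
      have h1 : 1 / ((k + 1).factorial : ℝ) = (1 / (k.factorial : ℝ)) / (k + 1) := by
        rw [Nat.factorial_succ]; push_cast; field_simp
      rw [h1]
      exact div_le_div₀ (by positivity) ih.1 (by positivity) (by linarith)
    have e1 : airyCoeff m e k / (N * (N - 1)) * N = airyCoeff m e k / (N - 1) := by
      have : N ≠ 0 := by linarith
      have : N - 1 ≠ 0 := by linarith
      field_simp
    have h2 : 0 ≤ airyCoeff m e k / (N * (N - 1)) :=
      div_nonneg h0 (mul_nonneg (by linarith) (by linarith))
    refine ⟨?_, e1 ▸ key⟩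
    calc _ ≤ airyCoeff m e k / (N * (N - 1)) * N := le_mul_of_one_le_right h2 (by linarith)
      _ ≤ _ := e1 ▸ key

/-- Summable majorant for the power series and its first two derivatives on `|x| ≤ R`. -/
noncomputable def airyMajorant (m : ℕ) (R : ℝ) (k : ℕ) : ℝ :=
  (m + 2) * R * ((2 * R ^ (m + 2)) ^ k / (k.factorial : ℝ))

lemma summable_airyMajorant (m : ℕ) (R : ℝ) : Summable (airyMajorant m R) :=
  (Real.summable_pow_div_factorial _).mul_left _

/-- One majorant serves the series and both termwise derivatives: since `R ≥ 1`, lowering the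
exponent costs nothing, and the factor `(m + 2) * 2 ^ k` absorbs the extra degree produced by the
second differentiation. -/
lemma abs_le_airyMajorant {m e : ℕ} (he : e ≤ 1) {R x c : ℝ} (hR : 1 ≤ R) (hx : |x| ≤ R) (k j : ℕ)
    (hj : j ≤ k * (m + 2) + e) (hc : |c| ≤ (m + 2) * 2 ^ k / (k.factorial : ℝ)) :
    |c * x ^ j| ≤ airyMajorant m R k := by
  rw [abs_mul, abs_pow, airyMajorant]
  have h1 : |x| ^ j ≤ R * (R ^ (m + 2)) ^ k := by
    calc |x| ^ j ≤ R ^ j := pow_le_pow_left₀ (abs_nonneg _) hx _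
      _ ≤ R ^ ((m + 2) * k + 1) := pow_le_pow_right₀ hR (by nlinarith)
      _ = _ := by rw [pow_succ, pow_mul, mul_comm]
  calc _ ≤ ((m + 2) * 2 ^ k / (k.factorial : ℝ)) * (R * (R ^ (m + 2)) ^ k) :=
        mul_le_mul hc h1 (by positivity) (by positivity)
    _ = _ := by rw [mul_pow]; ring

/-- The equation links the coefficient of `x^N` only to that of `x^(N-m-2)`, so the series starting
at `x^e` has degrees `k(m+2)+e`. Its coefficients are nonnegative, so on `[0, ∞)` it dominates its
leading term. -/
lemma exists_powerSeries_solution (m e : ℕ) (he : e ≤ 1) :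
    ∃ y y' : ℝ → ℝ, (∀ x, HasDerivAt y (y' x) x) ∧ (∀ x, HasDerivAt y' (x ^ m * y x) x) ∧
      y 0 = 0 ^ e ∧ y' 0 = e ∧ ∀ x, 0 ≤ x → x ^ e ≤ y x := by
  obtain ⟨N, hN⟩ : ∃ N : ℕ → ℕ, ∀ k, N k = k * (m + 2) + e := ⟨_, fun _ => rfl⟩
  obtain ⟨c, hc0, hcs, c0, cb⟩ : ∃ c : ℕ → ℝ, c 0 = 1 ∧
      (∀ k, c (k + 1) = c k / ((N (k + 1) : ℝ) * ((N (k + 1) : ℝ) - 1))) ∧ (∀ k, 0 ≤ c k) ∧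
      ∀ k, c k ≤ 1 / (k.factorial : ℝ) ∧ c k * (N k : ℝ) ≤ 1 / (k.factorial : ℝ) :=
    ⟨airyCoeff m e, rfl, fun k => by rw [hN]; rfl, airyCoeff_nonneg m e,
      fun k => by rw [hN]; exact airyCoeff_mul_degree_le he k⟩
  have hone : ∀ k : ℕ, 1 / (k.factorial : ℝ) ≤ (m + 2) * 2 ^ k / (k.factorial : ℝ) := by
    intro k
    gcongr
    have : (1 : ℝ) ≤ 2 ^ k := one_le_pow₀ (by norm_num)
    have : (0 : ℝ) ≤ m := Nat.cast_nonneg m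
    nlinarith
  have cA : ∀ k, |c k| ≤ (m + 2) * 2 ^ k / (k.factorial : ℝ) := fun k => by
    rw [abs_of_nonneg (c0 k)]; exact (cb k).1.trans (hone k)
  have cB : ∀ k, |c k * N k| ≤ (m + 2) * 2 ^ k / (k.factorial : ℝ) := fun k => by
    rw [abs_of_nonneg (mul_nonneg (c0 k) (Nat.cast_nonneg _))]; exact (cb k).2.trans (hone k)
  have cC : ∀ k, |c k * N k * ((N k - 1 : ℕ) : ℝ)| ≤ (m + 2) * 2 ^ k / (k.factorial : ℝ) := by
    intro k
    rw [abs_of_nonneg (mul_nonneg (mul_nonneg (c0 k) (Nat.cast_nonneg _)) (Nat.cast_nonneg _))]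
    have h1 : ((N k - 1 : ℕ) : ℝ) ≤ (m + 2) * 2 ^ k := by
      have h2 : N k - 1 ≤ (m + 2) * k := by simp only [hN]; nlinarith [Nat.sub_le_iff_le_add.2 (show k * (m + 2) + e ≤ (m + 2) * k + 1 by nlinarith)]
      have h3 : k ≤ 2 ^ k := Nat.lt_two_pow_self.le
      have h4 : N k - 1 ≤ (m + 2) * 2 ^ k := h2.trans (Nat.mul_le_mul_left _ h3)
      exact_mod_cast h4
    calc _ ≤ 1 / (k.factorial : ℝ) * ((m + 2) * 2 ^ k) :=
          mul_le_mul (cb k).2 h1 (Nat.cast_nonneg _) (by positivity)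
      _ = _ := by ring
  have sum0 : ∀ x, Summable fun k => c k * x ^ N k := fun x =>
    .of_norm_bounded (summable_airyMajorant m (max 1 |x|)) fun k =>
      abs_le_airyMajorant he (le_max_left _ _) (le_max_right _ _) k _ (hN k).le (cA k)
  have sum1 : ∀ x, Summable fun k => c k * N k * x ^ (N k - 1) := fun x =>
    .of_norm_bounded (summable_airyMajorant m (max 1 |x|)) fun k =>
      abs_le_airyMajorant he (le_max_left _ _) (le_max_right _ _) k _ ((Nat.sub_le _ _).trans (hN k).le) (cB k)
  have hball : ∀ x : ℝ, x ∈ Metric.ball (0 : ℝ) (|x| + 1) := fun x => by simp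
  have hbd : ∀ x y : ℝ, y ∈ Metric.ball (0 : ℝ) (|x| + 1) → |y| ≤ |x| + 1 := fun x y hy => by
    simpa using (Metric.mem_ball.1 hy).le
  refine ⟨fun x => ∑' k, c k * x ^ N k, fun x => ∑' k, c k * N k * x ^ (N k - 1), ?_, ?_, ?_, ?_, ?_⟩
  · intro x
    refine hasDerivAt_tsum_of_isPreconnected (g := fun k x => c k * x ^ N k)
      (g' := fun k x => c k * N k * x ^ (N k - 1)) (y₀ := x) (summable_airyMajorant m (|x| + 1))
      Metric.isOpen_ball (convex_ball _ _).isPreconnected ?_ ?_ (hball x) (sum0 x) (hball x)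
    · intro k y _
      simpa [mul_assoc] using (hasDerivAt_pow (N k) y).const_mul (c k)
    · intro k y hy
      exact abs_le_airyMajorant he (by simp) (hbd x y hy) k _ ((Nat.sub_le _ _).trans (hN k).le) (cB k)
  · intro x
    have h2 : HasDerivAt (fun x => ∑' k, c k * N k * x ^ (N k - 1))
        (∑' k, c k * N k * ((N k - 1 : ℕ) : ℝ) * x ^ (N k - 1 - 1)) x := by
      refine hasDerivAt_tsum_of_isPreconnected (g := fun k x => c k * N k * x ^ (N k - 1))
        (g' := fun k x => c k * N k * ((N k - 1 : ℕ) : ℝ) * x ^ (N k - 1 - 1)) (y₀ := x) (summable_airyMajorant m (|x| + 1))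
        Metric.isOpen_ball (convex_ball _ _).isPreconnected ?_ ?_ (hball x) (sum1 x) (hball x)
      · intro k y _
        simpa [mul_assoc] using (hasDerivAt_pow (N k - 1) y).const_mul (c k * N k)
      · intro k y hy
        exact abs_le_airyMajorant he (by simp) (hbd x y hy) k _
          ((Nat.sub_le _ _).trans ((Nat.sub_le _ _).trans (hN k).le)) (cC k)
    have sum2 : Summable fun k => c k * N k * ((N k - 1 : ℕ) : ℝ) * x ^ (N k - 1 - 1) :=
      .of_norm_bounded (summable_airyMajorant m (max 1 |x|)) fun k =>
        abs_le_airyMajorant he (le_max_left _ _) (le_max_right _ _) k _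
          ((Nat.sub_le _ _).trans ((Nat.sub_le _ _).trans (hN k).le)) (cC k)
    convert h2 using 1
    rw [sum2.tsum_eq_zero_add, ← tsum_mul_left]
    -- The leading term has degree at most 1 and is killed by two derivatives; the remaining terms,
    -- shifted by one index, reproduce `x^m y`.
    have hz : c 0 * N 0 * ((N 0 - 1 : ℕ) : ℝ) = 0 := by
      interval_cases e <;> simp [hN]
    rw [hz, zero_mul, zero_add]
    refine tsum_congr fun k => ?_
    have hN2 : N (k + 1) = N k + m + 2 := by simp only [hN]; ring
    have e1 : c (k + 1) * N (k + 1) * ((N (k + 1) - 1 : ℕ) : ℝ) = c k := by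
      rw [hcs, hN2]
      have : ((N k + m + 2 - 1 : ℕ) : ℝ) = (N k : ℝ) + m + 1 := by
        rw [show N k + m + 2 - 1 = N k + m + 1 by omega]; push_cast; ring
      rw [this]; push_cast
      have h3 : (N k : ℝ) + m + 2 - 1 = (N k : ℝ) + m + 1 := by ring
      rw [h3]
      field_simp
    rw [e1, show N (k + 1) - 1 - 1 = m + N k by omega, pow_add]
    ring
  · simp only
    rw [tsum_eq_single 0]
    · simp [hN, hc0]
    · intro k hk
      have : N k ≠ 0 := by simp only [hN]; positivity
      simp [this]
  · simp only
    rw [tsum_eq_single 0]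
    · interval_cases e <;> simp [hN, hc0]
    · intro k hk
      have : N k - 1 ≠ 0 := by
        have : 1 ≤ k := Nat.one_le_iff_ne_zero.2 hk
        have : 2 ≤ N k := by simp only [hN]; nlinarith
        omega
      simp [this]
  · intro x hx
    have := (sum0 x).le_tsum 0 fun k _ => mul_nonneg (c0 k) (pow_nonneg hx _)
    simpa [hN, hc0] using this

/-! ### The bounded solution on the non-oscillating side. -/

/-- `y'' = x ^ m * y` has a solution which is nonnegative and nonincreasing on `[0, ∞)` and does not
vanish at `0`. -/
lemma exists_decaying_solution (m : ℕ) :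
    ∃ B B' : ℝ → ℝ, (∀ x, HasDerivAt B (B' x) x) ∧ (∀ x, HasDerivAt B' (x ^ m * B x) x) ∧
      0 < B 0 ∧ ∀ x, 0 ≤ x → |B x| ≤ B 0 ∧ |B' x| ≤ |B' 0| := by
  obtain ⟨u, u', hu, hu', u0, u0', hu1⟩ := exists_powerSeries_solution m 0 (by norm_num)
  obtain ⟨w, w', hw, hw', w0, w0', hw1⟩ := exists_powerSeries_solution m 1 le_rfl
  simp only [pow_zero, pow_one, Nat.cast_zero, Nat.cast_one] at *
  -- The equation has no first-order term, so the Wronskian is constant.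
  have wronskian : ∀ x, u x * w' x - u' x * w x = 1 := by
    have hd : ∀ x, HasDerivAt (fun x => u x * w' x - u' x * w x) 0 x := fun x => by
      refine (((hu x).mul (hw' x)).sub ((hu' x).mul (hw x))).congr_deriv ?_
      ring
    intro x
    have := is_const_of_deriv_eq_zero (fun x => (hd x).differentiableAt) (fun x => (hd x).deriv) x 0
    simp only [u0, u0', w0', w0] at this
    simpa using this
  have u_pos : ∀ x, 0 ≤ x → 0 < u x := fun x hx => one_pos.trans_le (hu1 x hx)
  have u'_pos : ∀ x, 0 < x → 0 < u' x := by
    have hm : StrictMonoOn u' (Set.Ici 0) := by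
      refine strictMonoOn_of_deriv_pos (convex_Ici 0)
        (fun x _ => (hu' x).continuousAt.continuousWithinAt) fun x hx => ?_
      rw [interior_Ici, Set.mem_Ioi] at hx
      rw [(hu' x).deriv]
      exact mul_pos (pow_pos hx _) (u_pos x hx.le)
    intro x hx
    have := hm (Set.mem_Ici.2 le_rfl) (Set.mem_Ici.2 hx.le) hx
    rwa [u0'] at this
  -- The solution sought is `κ u - w`; it is nonnegative and nonincreasing on `(0, ∞)` exactly when
  -- `w/u ≤ κ ≤ w'/u'` there. By the Wronskian identity `w/u` increases, `w'/u'` decreases, and the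
  -- first lies below the second, so such a `κ` exists.
  have mono : MonotoneOn (fun x => w x / u x) (Set.Ioi 0) := by
    refine monotoneOn_of_hasDerivWithinAt_nonneg (f' := fun x => (w' x * u x - w x * u' x) / u x ^ 2)
      (convex_Ioi 0) (fun x hx => ?_) (fun x hx => ?_) fun x hx => ?_
    · exact ((hw x).div (hu x) (u_pos x (le_of_lt hx)).ne').continuousAt.continuousWithinAt
    · rw [interior_Ioi] at hx
      exact ((hw x).div (hu x) (u_pos x (le_of_lt hx)).ne').hasDerivWithinAt
    · rw [show w' x * u x - w x * u' x = 1 by linarith [wronskian x]]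
      positivity
  have anti : AntitoneOn (fun x => w' x / u' x) (Set.Ioi 0) := by
    refine antitoneOn_of_hasDerivWithinAt_nonpos
      (f' := fun x => (x ^ m * w x * u' x - w' x * (x ^ m * u x)) / u' x ^ 2)
      (convex_Ioi 0) (fun x hx => ?_) (fun x hx => ?_) fun x hx => ?_
    · exact ((hw' x).div (hu' x) (u'_pos x hx).ne').continuousAt.continuousWithinAt
    · rw [interior_Ioi] at hx
      exact ((hw' x).div (hu' x) (u'_pos x hx).ne').hasDerivWithinAt
    · rw [interior_Ioi, Set.mem_Ioi] at hx
      rw [show x ^ m * w x * u' x - w' x * (x ^ m * u x) = - x ^ m by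
        linear_combination (-x ^ m) * wronskian x]
      exact div_nonpos_of_nonpos_of_nonneg (neg_nonpos.2 (pow_nonneg hx.le _)) (sq_nonneg _)
  have cross : ∀ x, 0 < x → w x / u x ≤ w' x / u' x := fun x hx => by
    rw [div_le_div_iff₀ (u_pos x hx.le) (u'_pos x hx)]
    linarith [wronskian x]
  have sep : ∀ s r, 0 < s → 0 < r → w s / u s ≤ w' r / u' r := fun s r hs hr => by
    rcases le_total s r with h | h
    · exact (mono hs hr h).trans (cross r hr)
    · exact (cross s hs).trans (anti hr hs h)
  obtain ⟨κ, hκ1, hκ2⟩ : ∃ κ, (∀ s, 0 < s → w s / u s ≤ κ) ∧ ∀ r, 0 < r → κ ≤ w' r / u' r := by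
    refine ⟨sSup ((fun s => w s / u s) '' Set.Ioi 0), fun s hs => ?_, fun r hr => ?_⟩
    · refine le_csSup ⟨w' 1 / u' 1, ?_⟩ (Set.mem_image_of_mem _ hs)
      rintro _ ⟨s, hs, rfl⟩
      exact sep s 1 hs one_pos
    · refine csSup_le (Set.Nonempty.image _ ⟨1, Set.mem_Ioi.2 one_pos⟩) ?_
      rintro _ ⟨s, hs, rfl⟩
      exact sep s r hs hr
  have κ_pos : 0 < κ := (div_pos (one_pos.trans_le (hw1 1 zero_le_one)) (u_pos 1 zero_le_one)).trans_le
    (hκ1 1 one_pos)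
  have hB : ∀ x, HasDerivAt (fun x => κ * u x - w x) (κ * u' x - w' x) x := fun x =>
    ((hu x).const_mul κ).sub (hw x)
  have hB' : ∀ x, HasDerivAt (fun x => κ * u' x - w' x) (x ^ m * (κ * u x - w x)) x := fun x => by
    refine (((hu' x).const_mul κ).sub (hw' x)).congr_deriv ?_
    ring
  have B0 : κ * u 0 - w 0 = κ := by rw [u0, w0]; ring
  have B_nonneg : ∀ x, 0 ≤ x → 0 ≤ κ * u x - w x := fun x hx => by
    rcases hx.eq_or_lt with rfl | hx
    · rw [B0]; exact κ_pos.le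
    · have := hκ1 x hx
      rw [div_le_iff₀ (u_pos x hx.le)] at this
      linarith
  have B'_nonpos : ∀ x, 0 < x → κ * u' x - w' x ≤ 0 := fun x hx => by
    have := hκ2 x hx
    rw [le_div_iff₀ (u'_pos x hx)] at this
    linarith
  have B'_zero : κ * u' 0 - w' 0 ≤ 0 := by rw [u0', w0']; norm_num
  have B_anti : AntitoneOn (fun x => κ * u x - w x) (Set.Ici 0) := by
    refine antitoneOn_of_hasDerivWithinAt_nonpos (convex_Ici 0)
      (fun x _ => (hB x).continuousAt.continuousWithinAt) (fun x _ => (hB x).hasDerivWithinAt)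
      fun x hx => ?_
    rw [interior_Ici] at hx
    exact B'_nonpos x hx
  have B'_mono : MonotoneOn (fun x => κ * u' x - w' x) (Set.Ici 0) := by
    refine monotoneOn_of_hasDerivWithinAt_nonneg (convex_Ici 0)
      (fun x _ => (hB' x).continuousAt.continuousWithinAt) (fun x _ => (hB' x).hasDerivWithinAt)
      fun x hx => ?_
    rw [interior_Ici] at hx
    exact mul_nonneg (pow_nonneg (le_of_lt hx) _) (B_nonneg x (le_of_lt hx))
  refine ⟨_, _, hB, hB', by rw [B0]; exact κ_pos, fun x hx => ⟨?_, ?_⟩⟩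
  · rw [abs_of_nonneg (B_nonneg x hx)]
    exact B_anti (Set.mem_Ici.2 le_rfl) (Set.mem_Ici.2 hx) hx
  · have h1 : κ * u' 0 - w' 0 ≤ κ * u' x - w' x :=
      B'_mono (Set.mem_Ici.2 le_rfl) (Set.mem_Ici.2 hx) hx
    have h2 : κ * u' x - w' x ≤ 0 := by
      rcases hx.eq_or_lt with rfl | hx
      · exact B'_zero
      · exact B'_nonpos x hx
    exact abs_le_abs_of_nonpos h2 h1

/-! ### Growth on the oscillating side, and the global Airy function. -/

/-- Energy estimate for oscillating solutions of `A'' + x ^ m * A = 0` at `+∞`. -/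
lemma exists_energy_bound {m : ℕ} (hm : 1 ≤ m) {A A' : ℝ → ℝ} (hA : ∀ x, HasDerivAt A (A' x) x)
    (hA' : ∀ x, HasDerivAt A' (-x ^ m * A x) x) :
    ∃ C : ℝ, 0 ≤ C ∧ ∀ x : ℝ, (m : ℝ) ≤ x → A' x ^ 2 + x ^ m * A x ^ 2 ≤ C * x ^ ((m : ℝ) / 2) := by
  have hm' : (1 : ℝ) ≤ m := by exact_mod_cast hm
  set c : ℝ := m / 2 + m ^ 2 / 4 with hc
  set H : ℝ → ℝ := fun x => A' x ^ 2 + x ^ m * A x ^ 2 with hH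
  -- The energy satisfies `H' = m x^(m-1) A²`, which sees only the potential part. The cross term
  -- averages potential and kinetic parts, so that `W' = (m/(2x)) W` up to an error of order `x⁻² A
  -- A'`.
  set W : ℝ → ℝ := fun x => H x + m / 2 * (x⁻¹ * (A x * A' x)) with hW
  have dW : ∀ x, (m : ℝ) ≤ x →
      HasDerivAt W (m / 2 * x⁻¹ * W x - c * (x⁻¹ ^ 2 * (A x * A' x))) x := by
    intro x hx
    have x0 : x ≠ 0 := by linarith
    have h1 := ((hA' x).pow 2).add ((hasDerivAt_pow m x).mul ((hA x).pow 2))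
    have h2 := ((hasDerivAt_inv x0).mul ((hA x).mul (hA' x))).const_mul ((m : ℝ) / 2)
    refine (h1.add h2).congr_deriv ?_
    obtain ⟨k, rfl⟩ : ∃ k, m = k + 1 := ⟨m - 1, by omega⟩
    simp only [hW, hH, hc, Nat.add_sub_cancel, Pi.pow_apply, Pi.mul_apply]
    field_simp
    push_cast
    ring
  have cross : ∀ x, (m : ℝ) ≤ x → |A x * A' x| ≤ H x / 2 := fun x hx => by
    have h1 : (1 : ℝ) ≤ x ^ m := one_le_pow₀ (hm'.trans hx)
    have h2 : A' x ^ 2 + A x ^ 2 ≤ H x := by simp only [hH]; nlinarith [sq_nonneg (A x)]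
    rw [abs_le]
    constructor <;> nlinarith [sq_nonneg (A x + A' x), sq_nonneg (A x - A' x)]
  -- For `x ≥ m` the correction is at most `H / 4`, so `W` controls `H`.
  have H_le : ∀ x, (m : ℝ) ≤ x → H x ≤ 2 * W x := fun x hx => by
    have h1 := cross x hx
    have x0 : 0 < x := by linarith
    have h2 : |m / 2 * (x⁻¹ * (A x * A' x))| ≤ H x / 4 := by
      rw [show (m : ℝ) / 2 * (x⁻¹ * (A x * A' x)) = (m / x) * ((A x * A' x) / 2) by field_simp,
        abs_mul, abs_of_nonneg (by positivity : 0 ≤ (m : ℝ) / x), abs_div, abs_two]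
      have h3 : (m : ℝ) / x ≤ 1 := (div_le_one x0).2 hx
      have := abs_nonneg (A x * A' x)
      calc _ ≤ 1 * (|A x * A' x| / 2) := by gcongr
        _ ≤ _ := by linarith
    have h4 : 0 ≤ H x := by linarith [abs_nonneg (A x * A' x)]
    simp only [hW]
    linarith [(abs_le.1 h2).1]
  -- The power is the integrating factor of `W' = (m/(2x)) W`. The factor `exp (c/x)` contributes
  -- `-c x⁻² W`, which dominates the error because `|A A'| ≤ H/2 ≤ W`.
  have anti : AntitoneOn (fun x => W x * (x ^ (-(m : ℝ) / 2) * Real.exp (c * x⁻¹))) (Set.Ici (m : ℝ)) := by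
    have key : ∀ x, (m : ℝ) ≤ x →
        HasDerivAt (fun x => W x * (x ^ (-(m : ℝ) / 2) * Real.exp (c * x⁻¹)))
          (-(c * x⁻¹ ^ 2 * (W x + A x * A' x)) * (x ^ (-(m : ℝ) / 2) * Real.exp (c * x⁻¹))) x := by
      intro x hx
      have x0 : x ≠ 0 := by linarith
      have h1 := (Real.hasDerivAt_rpow_const (p := -(m : ℝ) / 2) (Or.inl x0))
      have h2 := ((hasDerivAt_inv x0).const_mul c).exp
      refine ((dW x hx).mul (h1.mul h2)).congr_deriv ?_
      rw [Real.rpow_sub_one x0, Pi.mul_apply]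
      field_simp
      ring
    refine antitoneOn_of_hasDerivWithinAt_nonpos (convex_Ici _)
      (fun x hx => (key x hx).continuousAt.continuousWithinAt)
      (fun x hx => (key x (interior_subset hx)).hasDerivWithinAt) fun x hx => ?_
    have hx' : (m : ℝ) ≤ x := interior_subset hx
    have x0 : 0 < x := by linarith
    have h1 : 0 ≤ W x + A x * A' x := by
      linarith [(abs_le.1 (cross x hx')).1, H_le x hx']
    rw [neg_mul]
    exact neg_nonpos.2 (by positivity)
  set C := W m * ((m : ℝ) ^ (-(m : ℝ) / 2) * Real.exp (c * (m : ℝ)⁻¹)) with hC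
  have H_nonneg : ∀ x, (m : ℝ) ≤ x → 0 ≤ H x := fun x hx => by
    linarith [cross x hx, abs_nonneg (A x * A' x)]
  have C0 : 0 ≤ C := mul_nonneg (by linarith [H_le m le_rfl, H_nonneg m le_rfl]) (by positivity)
  refine ⟨2 * C, by linarith, fun x hx => ?_⟩
  have x0 : 0 < x := by linarith
  have h1 : W x * (x ^ (-(m : ℝ) / 2) * Real.exp (c * x⁻¹)) ≤ C :=
    anti (Set.mem_Ici.2 le_rfl) (Set.mem_Ici.2 hx) hx
  have W0 : 0 ≤ W x := by linarith [H_le x hx, H_nonneg x hx]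
  have h2 : 1 ≤ Real.exp (c * x⁻¹) := Real.one_le_exp (by positivity)
  have h3 : W x * x ^ (-(m : ℝ) / 2) ≤ C := by
    refine le_trans ?_ h1
    gcongr
    exact le_mul_of_one_le_right (by positivity) h2
  have h4 : W x ≤ C * x ^ ((m : ℝ) / 2) := by
    rw [neg_div, Real.rpow_neg x0.le, ← div_eq_mul_inv, div_le_iff₀ (by positivity)] at h3
    exact h3
  calc H x ≤ 2 * W x := H_le x hx
    _ ≤ _ := by linarith

/-- The generalized Airy function: a solution of `A'' + x ^ m * A = 0`, `m` odd, bounded on `ℝ`,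
whose derivative grows at most like `|x| ^ (m / 4)`. -/
lemma exists_airy {m : ℕ} (hm : Odd m) :
    ∃ A A' : ℝ → ℝ, (∀ x, HasDerivAt A (A' x) x) ∧ (∀ x, HasDerivAt A' (-x ^ m * A x) x) ∧
      A 0 = 1 ∧ ∃ C : ℝ, ∀ x, |A x| ≤ C ∧ |A' x| ≤ C * (1 + |x|) ^ ((m : ℝ) / 4) := by
  obtain ⟨B, B', hB, hB', B0, hb⟩ := exists_decaying_solution m
  -- Reflection turns `B'' = x^m B` into `A'' = -x^m A` because `m` is odd; dividing by `B 0`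
  -- normalizes the value at `0`.
  have hA : ∀ x, HasDerivAt (fun x => B (-x) / B 0) (-B' (-x) / B 0) x := fun x => by
    have := ((hB (-x)).comp x (hasDerivAt_neg x)).div_const (B 0)
    refine this.congr_deriv ?_
    ring
  have hA' : ∀ x, HasDerivAt (fun x => -B' (-x) / B 0) (-x ^ m * (B (-x) / B 0)) x := fun x => by
    have := (((hB' (-x)).comp x (hasDerivAt_neg x)).neg).div_const (B 0)
    refine this.congr_deriv ?_
    rw [hm.neg_pow]
    ring
  have hm1 : 1 ≤ m := hm.pos
  have hm' : (1 : ℝ) ≤ m := by exact_mod_cast hm1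
  set A := fun x => B (-x) / B 0
  set A' := fun x => -B' (-x) / B 0
  obtain ⟨K, K0, hK⟩ := exists_energy_bound hm1 hA hA'
  have cA : Continuous A := continuous_iff_continuousAt.2 fun x => (hA x).continuousAt
  have cA' : Continuous A' := continuous_iff_continuousAt.2 fun x => (hA' x).continuousAt
  obtain ⟨K1, hK1⟩ := (isCompact_Icc (a := (0 : ℝ)) (b := m)).exists_bound_of_continuousOn cA.continuousOn
  obtain ⟨K2, hK2⟩ := (isCompact_Icc (a := (0 : ℝ)) (b := m)).exists_bound_of_continuousOn cA'.continuousOn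
  have weight : ∀ x : ℝ, 1 ≤ (1 + |x|) ^ ((m : ℝ) / 4) := fun x =>
    Real.one_le_rpow (by linarith [abs_nonneg x]) (by positivity)
  set K3 := |B' 0| / B 0
  have K30 : 0 ≤ K3 := by positivity
  have K10 : 0 ≤ K1 := (norm_nonneg _).trans (hK1 0 ⟨le_rfl, by linarith⟩)
  have K20 : 0 ≤ K2 := (norm_nonneg _).trans (hK2 0 ⟨le_rfl, by linarith⟩)
  have sK : 0 ≤ Real.sqrt K := Real.sqrt_nonneg K
  refine ⟨A, A', hA, hA', by simp [A, B0.ne'],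
    1 + K1 + K2 + K3 + Real.sqrt K, fun x => ?_⟩
  suffices h : |A x| ≤ 1 + K1 + K2 + K3 + Real.sqrt K ∧ (|A' x| ≤ 1 + K1 + K2 + K3 + Real.sqrt K ∨
      |A' x| ≤ Real.sqrt K * (1 + |x|) ^ ((m : ℝ) / 4)) by
    refine ⟨h.1, ?_⟩
    rcases h.2 with h | h
    · exact h.trans (le_mul_of_one_le_right (by positivity) (weight x))
    · refine h.trans ?_
      gcongr
      linarith
  rcases le_total x 0 with hx | hx
  · obtain ⟨h1, h2⟩ := hb (-x) (by linarith)
    refine ⟨?_, Or.inl ?_⟩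
    · have : |A x| ≤ 1 := by
        simp only [A]
        rw [abs_div, abs_of_pos B0]
        exact (div_le_one B0).2 h1
      linarith
    · have : |A' x| ≤ K3 := by
        simp only [A']
        rw [abs_div, abs_of_pos B0, abs_neg]
        exact div_le_div_of_nonneg_right h2 B0.le
      linarith
  rcases le_total x m with hxm | hxm
  · have h1 := hK1 x ⟨hx, hxm⟩
    have h2 := hK2 x ⟨hx, hxm⟩
    rw [Real.norm_eq_abs] at h1 h2
    exact ⟨by linarith, Or.inl (by linarith)⟩
  · have h := hK x hxm
    have x1 : 1 ≤ x := by linarith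
    have x0 : 0 < x := by linarith
    have hp : x ^ ((m : ℝ) / 2) ≤ x ^ m := by
      rw [← Real.rpow_natCast]
      exact Real.rpow_le_rpow_of_exponent_le x1 (by linarith)
    have hxm0 : 0 < x ^ m := by positivity
    refine ⟨?_, Or.inr ?_⟩
    · have h1 : A x ^ 2 ≤ K := by
        have : x ^ m * A x ^ 2 ≤ x ^ m * K := by nlinarith [sq_nonneg (A' x)]
        exact le_of_mul_le_mul_left this hxm0
      have := Real.abs_le_sqrt h1
      linarith
    · have h1 : A' x ^ 2 ≤ K * x ^ ((m : ℝ) / 2) := by nlinarith [sq_nonneg (A x)]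
      have h2 := Real.abs_le_sqrt h1
      rw [Real.sqrt_mul K0, Real.sqrt_eq_rpow (x ^ _), ← Real.rpow_mul x0.le] at h2
      refine h2.trans ?_
      rw [show (m : ℝ) / 2 * (1 / 2) = m / 4 by ring]
      gcongr
      rw [abs_of_pos x0]; linarith

/-! ### Continuity and differentiability of multiplication operators on `L²`. -/

section BoundedMultiplier

open Filter Topology

variable {α : Type*} [MeasurableSpace α] {μ : Measure α}

/-- Multiplication of an `L²` function by a real function `a`, meant for bounded measurable `a`. -/
noncomputable def mulLp (a : α → ℝ) (f : Lp ℂ 2 μ) : Lp ℂ 2 μ :=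
  open Classical in
  -- The default value `0` keeps boundedness proofs out of the term; it is never taken for bounded
  -- measurable `a`.
  if h : MemLp (fun x => (a x : ℂ) * f x) 2 μ then h.toLp _ else 0

lemma memLp_ofReal_mul {a : α → ℝ} (ha : Measurable a) {C : ℝ} (hC : ∀ x, |a x| ≤ C)
    (f : Lp ℂ 2 μ) : MemLp (fun x => (a x : ℂ) * f x) 2 μ := by
  refine MemLp.of_le_mul (c := C) (Lp.memLp f) ?_ (Eventually.of_forall fun x => ?_)
  · exact (Complex.measurable_ofReal.comp ha).aestronglyMeasurable.mul (Lp.aestronglyMeasurable f)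
  · rw [norm_mul, Complex.norm_real, Real.norm_eq_abs]
    exact mul_le_mul_of_nonneg_right (hC x) (norm_nonneg _)

lemma coeFn_mulLp {a : α → ℝ} (ha : Measurable a) {C : ℝ} (hC : ∀ x, |a x| ≤ C) (f : Lp ℂ 2 μ) :
    mulLp a f =ᵐ[μ] fun x => (a x : ℂ) * f x := by
  have h := memLp_ofReal_mul ha hC f
  rw [mulLp, dif_pos h]
  exact h.coeFn_toLp

/-- Dominated convergence for `|a i - b|² |f|²` with majorant `(2C)² |f|²`. The separate bounds
`ha'` make the integral formula for the distance valid for every `i`, while the uniform bound holds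
only eventually. -/
lemma tendsto_mulLp {ι : Type*} {l : Filter ι} [l.IsCountablyGenerated] {a : ι → α → ℝ}
    {b : α → ℝ} (ha : ∀ i, Measurable (a i)) (hb : Measurable b) (ha' : ∀ i, ∃ C, ∀ x, |a i x| ≤ C)
    {C : ℝ} (haC : ∀ᶠ i in l, ∀ x, |a i x| ≤ C) (hbC : ∀ x, |b x| ≤ C)
    (hlim : ∀ x, Tendsto (fun i => a i x) l (𝓝 (b x))) (f : Lp ℂ 2 μ) :
    Tendsto (fun i => mulLp (a i) f) l (𝓝 (mulLp b f)) := by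
  rw [tendsto_iff_edist_tendsto_0]
  have hed : ∀ i, edist (mulLp (a i) f) (mulLp b f) =
      (∫⁻ x, (‖((a i x - b x : ℝ) : ℂ) * f x‖ₑ) ^ (2 : ℝ) ∂μ) ^ (1 / (2 : ℝ)) := by
    intro i
    obtain ⟨Ci, hCi⟩ := ha' i
    rw [Lp.edist_def, eLpNorm_eq_lintegral_rpow_enorm_toReal (by norm_num) (by norm_num)]
    simp only [ENNReal.toReal_ofNat]
    congr 1
    refine lintegral_congr_ae ?_
    filter_upwards [coeFn_mulLp (ha i) hCi f, coeFn_mulLp hb hbC f] with x h1 h2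
    simp only [Pi.sub_apply, h1, h2]
    push_cast
    ring_nf
  simp_rw [hed]
  have h0 : (0 : ENNReal) = (∫⁻ _, 0 ∂μ) ^ (1 / (2 : ℝ)) := by simp
  rw [h0]
  refine (ENNReal.continuous_rpow_const.tendsto _).comp ?_
  have hfin : ∫⁻ x, (‖((2 * C : ℝ) : ℂ) * f x‖ₑ) ^ (2 : ℝ) ∂μ ≠ ⊤ := by
    have h := (Lp.memLp f).const_mul ((2 * C : ℝ) : ℂ)
    have := (eLpNorm_lt_top_iff_lintegral_rpow_enorm_lt_top (by norm_num) (by norm_num)).1 h.2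
    simpa using this.ne
  refine tendsto_lintegral_filter_of_dominated_convergence' _ (Eventually.of_forall fun i => ?_)
    (haC.mono fun i hi => Eventually.of_forall fun x => ?_) hfin (Eventually.of_forall fun x => ?_)
  · exact (((Complex.measurable_ofReal.comp ((ha i).sub hb)).aemeasurable.mul
      (Lp.aestronglyMeasurable f).aemeasurable).enorm).pow_const _
  · refine ENNReal.rpow_le_rpow ?_ (by norm_num)
    rw [enorm_mul, enorm_mul]
    gcongr
    refine enorm_le_iff_norm_le.2 ?_
    rw [Complex.norm_real, Complex.norm_real, Real.norm_eq_abs, Real.norm_eq_abs]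
    calc |a i x - b x| ≤ |a i x| + |b x| := abs_sub _ _
      _ ≤ 2 * C := by linarith [hi x, hbC x]
      _ ≤ |2 * C| := le_abs_self _
  · have h1 : Tendsto (fun i => ((a i x - b x : ℝ) : ℂ) * f x) l (𝓝 (((b x - b x : ℝ) : ℂ) * f x)) :=
      ((Complex.continuous_ofReal.tendsto _).comp ((hlim x).sub_const _)).mul_const _
    have h2 := (ENNReal.continuous_rpow_const (y := 2)).tendsto _ |>.comp
      ((continuous_enorm.tendsto _).comp h1)
    simpa [Function.comp_def] using h2

lemma continuous_mulLp {a : ℝ → α → ℝ} (ha : ∀ t, Measurable (a t))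
    (hb : ∀ T : ℝ, ∃ C, ∀ t, |t| ≤ T → ∀ x, |a t x| ≤ C)
    (hcont : ∀ x, Continuous fun t => a t x) (f : Lp ℂ 2 μ) :
    Continuous fun t => mulLp (a t) f := by
  rw [continuous_iff_continuousAt]
  intro t₀
  obtain ⟨C, hC⟩ := hb (|t₀| + 1)
  refine tendsto_mulLp ha (ha t₀) (fun t => (hb |t|).imp fun C h => h t le_rfl) (C := C) ?_
    (hC t₀ (by linarith)) (fun x => (hcont x).tendsto t₀) f
  filter_upwards [continuous_abs.continuousAt.eventually_lt continuousAt_const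
    (show |t₀| < |t₀| + 1 by linarith)] with t ht using hC t ht.le

/-- The difference quotient is again a multiplication operator. The mean value inequality bounds its
symbol near `t₀` by the local bound on `a'`, so `tendsto_mulLp` applies. -/
lemma hasDerivAt_mulLp {a a' : ℝ → α → ℝ} (ha : ∀ t, Measurable (a t))
    (ha' : ∀ t, Measurable (a' t))
    (hb : ∀ t, ∃ C, ∀ x, |a t x| ≤ C)
    (hb' : ∀ T : ℝ, ∃ C, ∀ t, |t| ≤ T → ∀ x, |a' t x| ≤ C)
    (hder : ∀ t x, HasDerivAt (fun t => a t x) (a' t x) t) (f : Lp ℂ 2 μ) (t₀ : ℝ) :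
    HasDerivAt (fun t => mulLp (a t) f) (mulLp (a' t₀) f) t₀ := by
  rw [hasDerivAt_iff_tendsto_slope]
  have hslope : ∀ t, slope (fun t => mulLp (a t) f) t₀ t =
      mulLp (fun x => slope (fun t => a t x) t₀ t) f := by
    intro t
    obtain ⟨C₀, hC₀⟩ := hb t₀
    obtain ⟨C₁, hC₁⟩ := hb t
    have hbs : ∀ x, |slope (fun t => a t x) t₀ t| ≤ |(t - t₀)⁻¹| * (C₁ + C₀) := fun x => by
      rw [slope_def_field, div_eq_inv_mul, abs_mul]
      gcongr
      exact (abs_sub _ _).trans (add_le_add (hC₁ x) (hC₀ x))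
    have hms : Measurable fun x => slope (fun t => a t x) t₀ t := by
      simp_rw [slope_def_field]
      exact ((ha t).sub (ha t₀)).div_const _
    rw [slope_def_module]
    refine Lp.ext ?_
    filter_upwards [Lp.coeFn_smul (t - t₀)⁻¹ (mulLp (a t) f - mulLp (a t₀) f),
      Lp.coeFn_sub (mulLp (a t) f) (mulLp (a t₀) f), coeFn_mulLp (ha t) hC₁ f,
      coeFn_mulLp (ha t₀) hC₀ f, coeFn_mulLp hms hbs f] with x h1 h2 h3 h4 h5
    rw [h1, h5, Pi.smul_apply, h2, Pi.sub_apply, h3, h4, slope_def_field, Complex.real_smul]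
    push_cast
    ring
  refine Tendsto.congr (fun t => (hslope t).symm) ?_
  obtain ⟨C, hC⟩ := hb' (|t₀| + 1)
  refine tendsto_mulLp (fun t => ?_) (ha' t₀) (fun t => ?_) (C := C) ?_ (hC t₀ (by linarith))
    (fun x => hasDerivAt_iff_tendsto_slope.1 (hder t₀ x)) f
  · simp_rw [slope_def_field]
    exact ((ha t).sub (ha t₀)).div_const _
  · obtain ⟨C₀, hC₀⟩ := hb t₀
    obtain ⟨C₁, hC₁⟩ := hb t
    refine ⟨|(t - t₀)⁻¹| * (C₁ + C₀), fun x => ?_⟩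
    rw [slope_def_field, div_eq_inv_mul, abs_mul]
    gcongr
    exact (abs_sub _ _).trans (add_le_add (hC₁ x) (hC₀ x))
  · refine Filter.Eventually.filter_mono nhdsWithin_le_nhds ?_
    filter_upwards [Metric.ball_mem_nhds t₀ one_pos] with t ht x
    have hsub : ∀ s ∈ Metric.ball t₀ 1, |s| ≤ |t₀| + 1 := fun s hs => by
      have h1 : |s - t₀| < 1 := by simpa [Real.dist_eq] using hs
      linarith [abs_sub_abs_le_abs_sub s t₀]
    have := (convex_ball t₀ 1).norm_image_sub_le_of_norm_hasDerivWithin_le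
      (fun s _ => (hder s x).hasDerivWithinAt) (fun s hs => hC s (hsub s hs) x)
      (Metric.mem_ball_self one_pos) ht
    have hC0 : 0 ≤ C := (abs_nonneg _).trans (hC t₀ (by linarith) x)
    rw [slope_def_field, abs_div]
    exact div_le_of_le_mul₀ (abs_nonneg _) hC0 this

end BoundedMultiplier

/-! ### Fourier multipliers with smooth symbols, seen on the `L²` side. -/

section FourierSide

open FourierTransform

variable {E : Type*} [NormedAddCommGroup E] [InnerProductSpace ℝ E] [FiniteDimensional ℝ E]
  [MeasurableSpace E] [BorelSpace E]

lemma smulLeftCLM_toTemperedDistribution {g : E → ℂ} (hg : g.HasTemperateGrowth)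
    {f h : Lp ℂ 2 (volume : Measure E)} (hfh : h =ᵐ[volume] fun x => g x * f x) :
    smulLeftCLM ℂ g (f : 𝓢'(E, ℂ)) = (h : 𝓢'(E, ℂ)) := by
  ext u
  simp only [Lp.toTemperedDistribution_apply, smulLeftCLM_apply_apply]
  refine integral_congr_ae ?_
  filter_upwards [hfh] with x hx
  simp [hx, hg]
  ring

/-- A Fourier multiplier with smooth symbol `g` acts on the inverse Fourier transform of
`a * f` by multiplying the symbols, if `a` and `g * a` are bounded. -/
lemma fourierMultiplierCLM_fourierInv_mulLp {g a : E → ℝ}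
    (hg : (fun x => (g x : ℂ)).HasTemperateGrowth) (hgm : Measurable g) (ha : Measurable a)
    {C : ℝ} (hC : ∀ x, |a x| ≤ C) {D : ℝ} (hD : ∀ x, |g x * a x| ≤ D)
    (f : Lp ℂ 2 (volume : Measure E)) :
    fourierMultiplierCLM ℂ (fun x => (g x : ℂ)) ((𝓕⁻ (mulLp a f) : Lp ℂ 2 (volume : Measure E)) : 𝓢'(E, ℂ)) =
      ((𝓕⁻ (mulLp (fun x => g x * a x) f) : Lp ℂ 2 (volume : Measure E)) : 𝓢'(E, ℂ)) := by
  rw [fourierMultiplierCLM_apply, ← Lp.fourierInv_toTemperedDistribution_eq,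
    fourier_fourierInv_eq, ← Lp.fourierInv_toTemperedDistribution_eq]
  congr 1
  refine smulLeftCLM_toTemperedDistribution hg ?_
  filter_upwards [coeFn_mulLp ha hC f, coeFn_mulLp (hgm.mul ha) hD f] with x h1 h2
  rw [h1, show mulLp (fun x => g x * a x) f x = _ from h2]
  simp [mul_assoc]

end FourierSide

/-! ### Frequency scaling and symbol bounds. -/

section Symbols

variable {E : Type*} [NormedAddCommGroup E]

/-- The factor `(2 π ‖ξ‖) ^ (2 / (2 l + 1))` by which the equation at frequency `ξ` is rescaled to
the Airy type equation `A'' + x ^ (2 l - 1) * A = 0`. -/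
noncomputable def tricomiScale (l : ℕ) (ξ : E) : ℝ := (2 * Real.pi * ‖ξ‖) ^ (2 / (2 * (l : ℝ) + 1))

lemma tricomiScale_nonneg (l : ℕ) (ξ : E) : 0 ≤ tricomiScale l ξ := by
  unfold tricomiScale; positivity

lemma continuous_tricomiScale (l : ℕ) : Continuous (tricomiScale l : E → ℝ) := by
  unfold tricomiScale
  exact (continuous_const.mul continuous_norm).rpow_const fun _ => Or.inr (by positivity)

/-- Two powers of the scale come from differentiating `A(tμ)` twice and `2l - 1` from the
coefficient `(tμ)^(2l-1)`; together they must give the symbol of `-Δ`. -/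
lemma tricomiScale_pow (l : ℕ) (ξ : E) :
    tricomiScale l ξ ^ (2 * l + 1) = (2 * Real.pi) ^ 2 * ‖ξ‖ ^ 2 := by
  have h : (0 : ℝ) ≤ 2 * Real.pi * ‖ξ‖ := by positivity
  rw [tricomiScale, ← Real.rpow_natCast, ← Real.rpow_mul h]
  have : 2 / (2 * (l : ℝ) + 1) * ((2 * l + 1 : ℕ) : ℝ) = 2 := by push_cast; field_simp
  rw [this, Real.rpow_two]
  ring

lemma tricomiScale_le (l : ℕ) (ξ : E) :
    tricomiScale l ξ ≤ (2 * Real.pi) ^ (2 / (2 * (l : ℝ) + 1)) *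
      (1 + ‖ξ‖ ^ 2) ^ (1 / (2 * (l : ℝ) + 1)) := by
  rw [tricomiScale, Real.mul_rpow (by positivity) (norm_nonneg _)]
  gcongr
  calc ‖ξ‖ ^ (2 / (2 * (l : ℝ) + 1)) = (‖ξ‖ ^ 2) ^ (1 / (2 * (l : ℝ) + 1)) := by
        rw [← Real.rpow_two, ← Real.rpow_mul (norm_nonneg _)]
        congr 1
        ring
    _ ≤ _ := by
      gcongr
      linarith

lemma continuous_weight (s : ℝ) : Continuous fun ξ : E => (1 + ‖ξ‖ ^ 2) ^ s :=
  (continuous_const.add (continuous_norm.pow 2)).rpow_const fun ξ =>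
    Or.inl (by positivity : (1 + ‖ξ‖ ^ 2 : ℝ) ≠ 0)

lemma weight_le_one {s : ℝ} (hs : s ≤ 0) (ξ : E) : (1 + ‖ξ‖ ^ 2) ^ s ≤ 1 :=
  Real.rpow_le_one_of_one_le_of_nonpos (by simp) hs

/-- The symbol bound behind the loss of derivatives in `∂ₜ v`. -/
lemma exists_scale_mul_deriv_bound {l : ℕ} (hl : 1 ≤ l) {A' : ℝ → ℝ} {C : ℝ}
    (hA' : ∀ x, |A' x| ≤ C * (1 + |x|) ^ (((2 * l - 1 : ℕ) : ℝ) / 4)) {s : ℝ}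
    (hs : (2 * (l : ℝ) + 3) / (2 * (2 * (l : ℝ) + 1)) ≤ s) (T : ℝ) :
    ∃ D, ∀ t, |t| ≤ T → ∀ ξ : E,
      |(1 + ‖ξ‖ ^ 2) ^ (-s / 2) * (tricomiScale l ξ * A' (t * tricomiScale l ξ))| ≤ D := by
  set q : ℝ := 1 / (2 * (l : ℝ) + 1) with hq
  have q0 : 0 < q := by positivity
  set K : ℝ := (2 * Real.pi) ^ (2 / (2 * (l : ℝ) + 1))
  have K0 : 0 < K := by positivity
  set r : ℝ := ((2 * l - 1 : ℕ) : ℝ) / 4 with hr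
  have r0 : 0 ≤ r := by positivity
  have hr' : r = (2 * (l : ℝ) - 1) / 4 := by
    rw [hr, Nat.cast_sub (by omega)]; push_cast; ring
  have C0 : 0 ≤ C := by
    have := (abs_nonneg _).trans (hA' 0)
    simpa using this
  refine ⟨K * (C * ((1 + |T|) * (1 + K)) ^ r), fun t ht ξ => ?_⟩
  have hμ := tricomiScale_le l ξ
  have hμ0 := tricomiScale_nonneg l ξ
  set μ := tricomiScale l ξ
  set J : ℝ := 1 + ‖ξ‖ ^ 2 with hJ
  have J1 : 1 ≤ J := by simp [hJ]
  have J0 : 0 < J := by linarith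
  have Jq : 1 ≤ J ^ q := Real.one_le_rpow J1 q0.le
  have ht' : |t| ≤ |T| := ht.trans (le_abs_self T)
  have h1 : 1 + |t * μ| ≤ (1 + |T|) * (1 + K) * J ^ q := by
    rw [abs_mul, abs_of_nonneg hμ0]
    have : |t| * μ ≤ |T| * (K * J ^ q) := mul_le_mul ht' hμ hμ0 (abs_nonneg _)
    have hT := abs_nonneg T
    have : 0 ≤ K * J ^ q := by positivity
    have : 0 ≤ |T| * J ^ q := by positivity
    nlinarith
  have h2 : |A' (t * μ)| ≤ C * (((1 + |T|) * (1 + K)) ^ r * J ^ (q * r)) := by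
    refine (hA' _).trans ?_
    rw [Real.rpow_mul J0.le, ← Real.mul_rpow (by positivity) (by positivity)]
    gcongr
  rw [abs_mul, abs_mul, abs_of_nonneg hμ0, abs_of_nonneg (by positivity : 0 ≤ J ^ (-s / 2))]
  calc J ^ (-s / 2) * (μ * |A' (t * μ)|)
      ≤ J ^ (-s / 2) * ((K * J ^ q) * (C * (((1 + |T|) * (1 + K)) ^ r * J ^ (q * r)))) := by gcongr
    _ = K * (C * ((1 + |T|) * (1 + K)) ^ r) * J ^ (-s / 2 + (q + q * r)) := by
      rw [Real.rpow_add J0, Real.rpow_add J0]; ring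
    _ ≤ K * (C * ((1 + |T|) * (1 + K)) ^ r) * 1 := by
      gcongr
      refine Real.rpow_le_one_of_one_le_of_nonpos J1 ?_
      -- Here `μ` costs `J^q` and `A'` costs `J^(q r)`; their sum is half the stated loss, as `J` is
      -- quadratic in `‖ξ‖`.
      have : q + q * r = (2 * (l : ℝ) + 3) / (2 * (2 * (l : ℝ) + 1)) / 2 := by
        rw [hq, hr']; field_simp; ring
      linarith
    _ = _ := mul_one _

end Symbols

/-! ### Construction of the solution and verification of its properties. -/

theorem lemma2p3 (n l : ℕ) (hl : 1 ≤ l) (γ : ℝ) (ψ : 𝓢'(EuclideanSpace ℝ (Fin n), ℂ))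
    (hψ : MemSobolev γ 2 ψ) :
    ∃ v : ℝ → 𝓢'(EuclideanSpace ℝ (Fin n), ℂ),
      SobolevContDiff 0 γ v ∧
      SobolevContDiff 1 (γ - (2 * (l : ℝ) + 3) / (2 * (2 * (l : ℝ) + 1))) v ∧
      SolvesGeneralizedTricomi l v ∧
      v 0 = ψ := by
  open FourierTransform in
  obtain ⟨g₀, hg₀⟩ := hψ
  obtain ⟨A, A', hA, hA', A0, C, hC⟩ := exists_airy (m := 2 * l - 1) ⟨l - 1, by omega⟩
  have cA : Continuous A := continuous_iff_continuousAt.2 fun x => (hA x).continuousAt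
  have cA' : Continuous A' := continuous_iff_continuousAt.2 fun x => (hA' x).continuousAt
  set σ : ℝ := (2 * (l : ℝ) + 3) / (2 * (2 * (l : ℝ) + 1)) with hσ
  have σ0 : 0 ≤ σ := by positivity
  have σ2 : σ ≤ 2 := by
    rw [hσ, div_le_iff₀ (by positivity)]
    linarith [(Nat.cast_nonneg l : (0 : ℝ) ≤ l)]
  let E := EuclideanSpace ℝ (Fin n)
  let X := Lp ℂ 2 (volume : Measure E)
  let f : X := 𝓕 g₀
  let μ : E → ℝ := tricomiScale l
  have cμ : Continuous μ := continuous_tricomiScale l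
  -- The parameter `s` counts the derivatives given up: `a s t` is the symbol of `⟨D⟩^(-s)` composed
  -- with the solution operator. It is used with `s = 0` for continuity in `H^γ`, `s = σ` for the
  -- first derivative, and `s = 2` for the equation, where `σ ≤ 2` keeps the first derivative
  -- bounded too.
  let a : ℝ → ℝ → E → ℝ := fun s t ξ => (1 + ‖ξ‖ ^ 2) ^ (-s / 2) * A (t * μ ξ)
  let a' : ℝ → ℝ → E → ℝ := fun s t ξ => (1 + ‖ξ‖ ^ 2) ^ (-s / 2) * (μ ξ * A' (t * μ ξ))
  let a'' : ℝ → E → ℝ := fun t ξ =>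
    (1 + ‖ξ‖ ^ 2) ^ (-(2 : ℝ) / 2) * (μ ξ * (μ ξ * (-(t * μ ξ) ^ (2 * l - 1) * A (t * μ ξ))))
  have ma : ∀ s t, Measurable (a s t) := fun s t =>
    ((continuous_weight _).mul (cA.comp (continuous_const.mul cμ))).measurable
  have ma' : ∀ s t, Measurable (a' s t) := fun s t =>
    ((continuous_weight _).mul (cμ.mul (cA'.comp (continuous_const.mul cμ)))).measurable
  have ma'' : ∀ t, Measurable (a'' t) := fun t =>
    ((continuous_weight _).mul (cμ.mul (cμ.mul (((continuous_const.mul cμ).pow _).neg.mul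
      (cA.comp (continuous_const.mul cμ)))))).measurable
  have ba : ∀ s, 0 ≤ s → ∀ t ξ, |a s t ξ| ≤ C := fun s hs t ξ => by
    simp only [a]
    rw [abs_mul, abs_of_nonneg (by positivity : (0 : ℝ) ≤ (1 + ‖ξ‖ ^ 2) ^ (-s / 2))]
    calc _ ≤ 1 * C := mul_le_mul (weight_le_one (by linarith) ξ) (hC _).1 (abs_nonneg _) zero_le_one
      _ = C := one_mul C
  have ba' : ∀ s, σ ≤ s → ∀ T : ℝ, ∃ D, ∀ t, |t| ≤ T → ∀ ξ, |a' s t ξ| ≤ D := fun s hs T =>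
    exists_scale_mul_deriv_bound hl (fun x => (hC x).2) hs T
  have a''_eq : ∀ t ξ, a'' t ξ = -(t ^ (2 * l - 1) * (2 * Real.pi) ^ 2) * (‖ξ‖ ^ 2 * a 2 t ξ) := by
    intro t ξ
    have h1 : μ ξ ^ (2 * l + 1) = (2 * Real.pi) ^ 2 * ‖ξ‖ ^ 2 := tricomiScale_pow l ξ
    rw [show 2 * l + 1 = (2 * l - 1) + 1 + 1 by omega, pow_succ, pow_succ] at h1
    simp only [a'', a, mul_pow]
    linear_combination (-(1 + ‖ξ‖ ^ 2) ^ (-(2 : ℝ) / 2) * t ^ (2 * l - 1) * A (t * μ ξ)) * h1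
  have bw : ∀ t ξ, |‖ξ‖ ^ 2 * a 2 t ξ| ≤ C := fun t ξ => by
    simp only [a]
    rw [← mul_assoc, abs_mul, abs_of_nonneg (by positivity)]
    calc _ ≤ 1 * C := by
          refine mul_le_mul ?_ (hC _).1 (abs_nonneg _) zero_le_one
          rw [show -(2 : ℝ) / 2 = -1 by norm_num, Real.rpow_neg_one, ← div_eq_mul_inv]
          exact (div_le_one (by positivity)).2 (by linarith)
      _ = C := one_mul C
  have ba'' : ∀ T : ℝ, ∃ D, ∀ t, |t| ≤ T → ∀ ξ, |a'' t ξ| ≤ D := fun T => by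
    refine ⟨T ^ (2 * l - 1) * (2 * Real.pi) ^ 2 * C, fun t ht ξ => ?_⟩
    have hT : 0 ≤ T := (abs_nonneg t).trans ht
    rw [a''_eq, abs_mul, abs_neg, abs_mul, abs_pow, abs_of_nonneg (sq_nonneg (2 * Real.pi))]
    have := bw t ξ
    gcongr
  have da : ∀ s t ξ, HasDerivAt (fun t => a s t ξ) (a' s t ξ) t := fun s t ξ => by
    have := ((hA (t * μ ξ)).comp t ((hasDerivAt_id t).mul_const (μ ξ))).const_mul
      ((1 + ‖ξ‖ ^ 2) ^ (-s / 2))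
    refine this.congr_deriv ?_
    simp only [a']
    ring
  have da' : ∀ t ξ, HasDerivAt (fun t => a' 2 t ξ) (a'' t ξ) t := fun t ξ => by
    have := (((hA' (t * μ ξ)).comp t ((hasDerivAt_id t).mul_const (μ ξ))).const_mul (μ ξ)).const_mul
      ((1 + ‖ξ‖ ^ 2) ^ (-(2 : ℝ) / 2))
    refine this.congr_deriv ?_
    simp only [a'']
    ring
  have cP : ∀ s, 0 ≤ s → Continuous fun t => mulLp (a s t) f := fun s hs =>
    continuous_mulLp (ma s) (fun T => ⟨C, fun t _ => ba s hs t⟩)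
      (fun ξ => continuous_iff_continuousAt.2 fun t => (da s t ξ).continuousAt) f
  have dP : ∀ s, σ ≤ s → ∀ t, HasDerivAt (fun t => mulLp (a s t) f) (mulLp (a' s t) f) t :=
    fun s hs => hasDerivAt_mulLp (ma s) (ma' s) (fun t => ⟨C, ba s (σ0.trans hs) t⟩) (ba' s hs)
      (da s) f
  have cP' : ∀ s, σ ≤ s → Continuous fun t => mulLp (a' s t) f := fun s hs =>
    continuous_mulLp (ma' s) (ba' s hs) (fun ξ => by
      exact continuous_const.mul (continuous_const.mul (cA'.comp (continuous_id.mul continuous_const)))) f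
  have dP' : ∀ t, HasDerivAt (fun t => mulLp (a' 2 t) f) (mulLp (a'' t) f) t :=
    hasDerivAt_mulLp (ma' 2) ma'' (fun t => (ba' 2 σ2 |t|).imp fun D h => h t le_rfl) ba'' da' f
  have cP'' : Continuous fun t => mulLp (a'' t) f :=
    continuous_mulLp ma'' ba'' (fun ξ => by
      have : Continuous fun t => t * μ ξ := continuous_id.mul continuous_const
      exact continuous_const.mul (continuous_const.mul (continuous_const.mul
        ((this.pow _).neg.mul (cA.comp this))))) f
  let F : X →L[ℂ] X := fourierInvCLM ℂ X
  have tw : ∀ s : ℝ, (fun ξ : E => (((1 + ‖ξ‖ ^ 2) ^ (s / 2) : ℝ) : ℂ)).HasTemperateGrowth :=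
    fun s => by fun_prop
  have tq : (fun ξ : E => ((‖ξ‖ ^ 2 : ℝ) : ℂ)).HasTemperateGrowth := by fun_prop
  have mw : ∀ t, Measurable fun ξ => ‖ξ‖ ^ 2 * a 2 t ξ := fun t =>
    (continuous_norm.pow 2).measurable.mul (ma 2 t)
  have bessel : ∀ s, 0 ≤ s → ∀ t, besselPotential E ℂ (-s) (F (mulLp (a 0 t) f) : 𝓢'(E, ℂ)) =
      (F (mulLp (a s t) f) : 𝓢'(E, ℂ)) := by
    intro s hs t
    have h0 : ∀ ξ, (1 + ‖ξ‖ ^ 2) ^ (-s / 2) * a 0 t ξ = a s t ξ := fun ξ => by simp [a]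
    have := fourierMultiplierCLM_fourierInv_mulLp (tw (-s)) (continuous_weight _).measurable (ma 0 t)
      (ba 0 le_rfl t) (D := C) (fun ξ => by rw [h0]; exact ba s hs t ξ) f
    simp_rw [h0] at this
    exact this
  refine ⟨fun t => besselPotential E ℂ (-γ) (F (mulLp (a 0 t) f) : 𝓢'(E, ℂ)), ?_, ?_, ?_, ?_⟩
  · refine ⟨fun t => F (mulLp (a 0 t) f), ?_, fun t => ?_⟩
    · exact contDiff_zero.2 (F.continuous.comp (cP 0 le_rfl))
    · simp [E]
  · refine ⟨fun t => F (mulLp (a σ t) f), ?_, fun t => ?_⟩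
    · have hd : ∀ t, HasDerivAt (fun t => F (mulLp (a σ t) f)) (F (mulLp (a' σ t) f)) t := fun t =>
        (F.restrictScalars ℝ).hasFDerivAt.comp_hasDerivAt t (dP σ le_rfl t)
      rw [Nat.cast_one, contDiff_one_iff_deriv]
      refine ⟨fun t => (hd t).differentiableAt, ?_⟩
      rw [funext fun t => (hd t).deriv]
      exact F.continuous.comp (cP' σ le_rfl)
    · rw [besselPotential_besselPotential_apply, show -γ + (γ - σ) = -σ by ring]
      exact bessel σ σ0 t
  · intro φ
    -- Since `⟨D⟩^(-γ) = ⟨D⟩^(2-γ) ⟨D⟩^(-2)`, the pairing `⟨v(t), φ⟩` is a fixed continuous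
    -- functional of the `L²` curve with symbol `a 2 t`, which is twice continuously differentiable.
    let L : X →L[ℂ] ℂ := (PointwiseConvergenceCLM.evalCLM (RingHom.id ℂ) ℂ φ) ∘L
      (besselPotential E ℂ (2 - γ)) ∘L (Lp.toTemperedDistributionCLM ℂ volume 2) ∘L F
    have hL : ∀ h, L h = besselPotential E ℂ (2 - γ) (F h : 𝓢'(E, ℂ)) φ := fun h => rfl
    have hv : (fun t => besselPotential E ℂ (-γ) (F (mulLp (a 0 t) f) : 𝓢'(E, ℂ)) φ) =
        fun t => L (mulLp (a 2 t) f) := by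
      funext t
      rw [hL, ← bessel 2 zero_le_two t, besselPotential_besselPotential_apply,
        show -2 + (2 - γ) = -γ by ring]
    have hd : ∀ t, HasDerivAt (fun t => L (mulLp (a 2 t) f)) (L (mulLp (a' 2 t) f)) t := fun t =>
      (L.restrictScalars ℝ).hasFDerivAt.comp_hasDerivAt t (dP 2 σ2 t)
    have hd' : ∀ t, HasDerivAt (fun t => L (mulLp (a' 2 t) f)) (L (mulLp (a'' t) f)) t := fun t =>
      (L.restrictScalars ℝ).hasFDerivAt.comp_hasDerivAt t (dP' t)
    have e1 : deriv (fun t => L (mulLp (a 2 t) f)) = fun t => L (mulLp (a' 2 t) f) :=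
      funext fun t => (hd t).deriv
    have e2 : deriv (fun t => L (mulLp (a' 2 t) f)) = fun t => L (mulLp (a'' t) f) :=
      funext fun t => (hd' t).deriv
    refine ⟨?_, fun t => ?_⟩
    · simp only [E] at hv
      rw [hv, show (2 : WithTop ℕ∞) = 1 + 1 by norm_num, contDiff_succ_iff_deriv]
      refine ⟨fun t => (hd t).differentiableAt, by simp, ?_⟩
      rw [e1, contDiff_one_iff_deriv]
      refine ⟨fun t => (hd' t).differentiableAt, ?_⟩
      rw [e2]
      exact L.continuous.comp cP''
    -- The Laplacian commutes with the Bessel potential and lands on the symbol `a 2 t`, whose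
    -- weight `(1 + ‖ξ‖²)⁻¹` keeps the product with `‖ξ‖²` bounded.
    · have hΔ : (Δ (besselPotential E ℂ (-γ) (F (mulLp (a 0 t) f) : 𝓢'(E, ℂ)))) φ =
          -(2 * Real.pi : ℂ) ^ 2 * L (mulLp (fun ξ => ‖ξ‖ ^ 2 * a 2 t ξ) f) := by
        have comm : ∀ Y : 𝓢'(E, ℂ), fourierMultiplierCLM ℂ (fun ξ : E => ((‖ξ‖ ^ 2 : ℝ) : ℂ))
            (besselPotential E ℂ (2 - γ) Y) = besselPotential E ℂ (2 - γ)
              (fourierMultiplierCLM ℂ (fun ξ : E => ((‖ξ‖ ^ 2 : ℝ) : ℂ)) Y) := fun Y => by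
          rw [besselPotential, fourierMultiplierCLM_fourierMultiplierCLM_apply (tw _) tq,
            fourierMultiplierCLM_fourierMultiplierCLM_apply tq (tw _), mul_comm]
        have mult : fourierMultiplierCLM ℂ (fun ξ : E => ((‖ξ‖ ^ 2 : ℝ) : ℂ))
            (F (mulLp (a 2 t) f) : 𝓢'(E, ℂ)) =
              (F (mulLp (fun ξ => ‖ξ‖ ^ 2 * a 2 t ξ) f) : 𝓢'(E, ℂ)) :=
          fourierMultiplierCLM_fourierInv_mulLp tq (continuous_norm.pow 2).measurable (ma 2 t)
            (ba 2 zero_le_two t) (bw t) f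
        rw [laplacian_eq_fourierMultiplierCLM, show -γ = -2 + (2 - γ) by ring,
          ← besselPotential_besselPotential_apply, bessel 2 zero_le_two t, comm, mult, hL, ← Complex.coe_smul (-(2 * Real.pi) ^ 2)]
        push_cast
        rfl
      have hP'' : mulLp (a'' t) f = (-(t ^ (2 * l - 1) * (2 * Real.pi) ^ 2 : ℝ) : ℂ) •
          mulLp (fun ξ => ‖ξ‖ ^ 2 * a 2 t ξ) f := by
        obtain ⟨D, hD⟩ := ba'' |t|
        refine Lp.ext ?_
        filter_upwards [coeFn_mulLp (ma'' t) (hD t le_rfl) f, coeFn_mulLp (mw t) (bw t) f,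
          Lp.coeFn_smul (-(t ^ (2 * l - 1) * (2 * Real.pi) ^ 2 : ℝ) : ℂ)
            (mulLp (fun ξ => ‖ξ‖ ^ 2 * a 2 t ξ) f)] with ξ h1 h2 h3
        rw [h1, h3, Pi.smul_apply, h2, a''_eq, smul_eq_mul]
        push_cast
        ring
      simp only [E] at hv hΔ
      rw [hv, iteratedDeriv_succ, iteratedDeriv_one, e1, e2, hΔ]
      simp only
      rw [hP'', map_smul, smul_eq_mul]
      push_cast
      ring
  · have h1 : mulLp (a 0 0) f = f := by
      refine Lp.ext ?_
      filter_upwards [coeFn_mulLp (ma 0 0) (ba 0 le_rfl 0) f] with ξ h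
      rw [h]
      simp [a, A0]
    have h2 : F f = g₀ := FourierTransform.fourierInv_fourier_eq (F := X) g₀
    simp only
    rw [h1, h2, ← hg₀]
    simp [E]
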